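/- **Setting.** Let $J\subset\mathbb R^d$ be a compact set with nonempty interior, and let $(n_k)_{k\ge1}$ be integers and $(r_k)_{k\ge1}$ real numbers with $n_k\ge 2$, $0<r_k<1$, $n_kr_k\le 1$ for all $k$ and $r:=\inf_k r_k>0$. Let $D_k=\prod_{j=1}^k\{1,\dots,n_j\}$ be the set of words of length $k$ ($D_0$ contains only the empty word $\emptyset$), and $D=\bigcup_{k\ge0}D_k$. A family $\{J_{\mathbf i}\}_{\mathbf i\in D}$ of subsets of $\mathbb R^d$ has the *Moran structure* for $(J,(n_k),(r_k))$ if 1. $J_\emptyset=J$; 2. for every $\mathbf i\in D$ there is a similarity $S_{\mathbf i}$ of $\mathbb R^d$ with $J_{\mathbf i}=S_{\mathbf i}(J)$; 3. for all $k\ge1$ and $\mathbf i\in D_{k-1}$, the sets $J_{\mathbf i1},\dots,J_{\mathbf in_k}$ are subsets of $J_{\mathbf i}$ with pairwise disjoint interiors; 4. $\operatorname{diam}J_{\mathbf ij}/\operatorname{diam}J_{\mathbf i}=r_k$ for all $k\ge1$, $\mathbf i\in D_{k-1}$, $1\le j\le n_k$. Its *Moran set* is $E=\bigcap_{k\ge0}\bigcup_{\mathbf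 i\in D_k}J_{\mathbf i}$. For $n\ge 0$ let $X_n$ be the set of words $i_1\cdots i_k\in D$ with $r_1\cdots r_k\le r^n<r_1\cdots r_{k-1}$ (so $X_0=\{\emptyset\}$, the second inequality being void for $k=0$). The *augmented tree* of the family is the graph with vertex set $X=\bigcup_{n\ge0}X_n$ and root $o=\emptyset$, whose edges join $\mathbf u\in X_n$ to $\mathbf v\in X_{n+1}$ if $\mathbf u$ is a prefix of $\mathbf v$, and join distinct $\mathbf u,\mathbf v\in X_n$, $n\ge1$, if $J_{\mathbf u}\cap J_{\mathbf v}\ne\emptyset$. The family satisfies *condition (H)* if there is $C'>0$ such that for all $n\ge1$ and $\mathbf u,\mathbf v\in X_n$, either $J_{\mathbf u}\cap J_{\mathbf v}\neq\emptyset$ or $\operatorname{dist}(J_{\mathbf u},J_{\mathbf v})\ge C'r^n$. Let $d(x,y)$ be the graph distance on $X$, $|x|=d(o,x)$, and $|x\wedge y|=\frac12(|x|+|y|-d(x,y))$. The graph is *hyperbolic with constant* $\delta>0$ if $|x\wedge y|\ge\min\{|x\wedge z|,|z\wedge y|\}-\delta$ for all $x,y,z\in X$, and *hyperbolic* if this holds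 for some $\delta>0$. Call $a>0$ *admissible* for $X$ if $e^{\delta a}-1<\sqrt2-1$ for some $\delta>0$ with which $X$ is hyperbolic. For such $a$ put $\rho_a(x,y)=e^{-a|x\wedge y|}$ if $x\ne y$ and $\rho_a(x,x)=0$. Then $\rho_a$ is equivalent, up to constant factors, to a metric on $X$, namely the largest metric not exceeding $\rho_a$, $(x,y)\mapsto\inf\sum_i\rho_a(x_i,x_{i+1})$, the infimum being over all finite chains from $x$ to $y$. The *hyperbolic boundary* is $\partial X=\hat X\setminus X$, where $\hat X$ is the completion of $X$ for this metric; $\partial X$ carries the metric of $\hat X$. Two metric spaces $A,B$ are *Lipschitz equivalent*, $A\simeq B$, if there are a bijection $\sigma:A\to B$ and a constant $C>0$ with $C^{-1}d_A(x,y)\le d_B(\sigma(x),\sigma(y))\le C\,d_A(x,y)$ for all $x,y\in A$. **Statement.** Let $E$ and $E'$ be the Moran sets of two families that have the Moran structure for the same $(J,(n_k),(r_k))$ and that both satisfy condition (H), and let $X$ and $Y$ be the augmented trees of these families. Then $X$ and $Y$ are hyperbolic, and for every $a>0$ that is admissible for both $X$ and $Y$, with the boundaries $\partial X$ and $\partial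 Y$ formed with this parameter $a$, $$E\simeq E'\iff\partial X\simeq\partial Y .$$ -/

import Mathlib

/-- The data `J`, `(n_k)`, `(r_k)` of a Moran class in `ℝ^d`, together with the standing assumptions
on them.  Sequences are indexed from `0`: `num k` and `ratio k` stand for `n_{k+1}` and `r_{k+1}`. -/
structure MoranParameters (d : ℕ) where
  J : Set (EuclideanSpace ℝ (Fin d))
  num : ℕ → ℕ
  ratio : ℕ → ℝ
  isCompact_J : IsCompact J
  interior_J_nonempty : (interior J).Nonempty
  two_le_num : ∀ k, 2 ≤ num k
  ratio_pos : ∀ k, 0 < ratio k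
  ratio_lt_one : ∀ k, ratio k < 1
  num_mul_ratio_le_one : ∀ k, (num k : ℝ) * ratio k ≤ 1
  iInf_ratio_pos : 0 < ⨅ k, ratio k

namespace MoranParameters

variable {d : ℕ} (P : MoranParameters d)

/-- The number `r = inf_k r_k`. -/
noncomputable def r : ℝ := ⨅ k, P.ratio k

/-- The product `r_1 ⋯ r_k` (equal to `1` for `k = 0`). -/
noncomputable def ratioProd (k : ℕ) : ℝ := ∏ j ∈ Finset.range k, P.ratio j

/-- The set `D` of finite words; the letter in position `j` is one of `0, …, num j - 1`. -/
abbrev Word : Type := {w : List ℕ // ∀ (j : ℕ) (h : j < w.length), w[j] < P.num j}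

variable {P}

/-- The length of a word: `D_k` is the set of words of length `k`. -/
def Word.length (w : P.Word) : ℕ := w.1.length

/-- The word `w i`, that is, the word `w` followed by the letter `i`. -/
def Word.child (w : P.Word) (i : Fin (P.num w.length)) : P.Word :=
  ⟨w.1 ++ [(i : ℕ)], by
    intro j h
    rw [List.getElem_append]
    split_ifs with hj
    · exact w.2 j hj
    · have hj' : j = w.length := by
        simp only [List.length_append, List.length_singleton] at h
        simp only [Word.length]
        omega
      subst hj'
      simp⟩

variable (P)

/-- The empty word. -/
def emptyWord : P.Word := ⟨[], by intro j h; simp at h⟩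

/-- The level `X_n`: the words `i_1 ⋯ i_k` with `r_1 ⋯ r_k ≤ r^n < r_1 ⋯ r_{k-1}`, where the second
inequality is void for the empty word `k = 0`. -/
def level (n : ℕ) : Set P.Word :=
  {w | P.ratioProd w.length ≤ P.r ^ n ∧ (0 < w.length → P.r ^ n < P.ratioProd (w.length - 1))}

/-- The vertex set `X`, the union of the levels `X_n`, `n ≥ 0`. -/
abbrev Vertex : Type := {w : P.Word // ∃ n, w ∈ P.level n}

/-- The root of `X`, the empty word. -/
def root : P.Vertex := ⟨P.emptyWord, 0, by simp [level, emptyWord, Word.length, ratioProd]⟩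

/-- The zeroth level consists of the empty word only. -/
theorem level_zero : P.level 0 = {P.emptyWord} := by
  have hprod : ∀ k, P.ratioProd k ≤ 1 := fun k =>
    Finset.prod_le_one (fun j _ => (P.ratio_pos j).le) (fun j _ => (P.ratio_lt_one j).le)
  ext w
  constructor
  · rintro ⟨-, h⟩
    have h0 : w.length = 0 := by
      by_contra h0
      have h1 := h (Nat.pos_of_ne_zero h0)
      rw [pow_zero] at h1
      exact absurd (hprod _) (not_le.mpr h1)
    exact Subtype.ext (List.eq_nil_of_length_eq_zero h0)
  · rintro rfl
    simp [level, emptyWord, Word.length, ratioProd]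

/-- The tree of vertical edges: `u` is joined to `v` if `u ∈ X_n` is the prefix of `v ∈ X_{n+1}` for
some `n` (or the other way round). -/
def verticalGraph : SimpleGraph P.Vertex :=
  SimpleGraph.fromRel fun u v =>
    ∃ n, u.1 ∈ P.level n ∧ v.1 ∈ P.level (n + 1) ∧ u.1.1 <+: v.1.1

end MoranParameters

/-- A family `{J_w : w ∈ D}` of sets in `ℝ^d` that has the Moran structure for given parameters. -/
structure MoranStructure {d : ℕ} (P : MoranParameters d) where
  piece : P.Word → Set (EuclideanSpace ℝ (Fin d))
  piece_empty : piece P.emptyWord = P.J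
  similar : ∀ w, ∃ S : EuclideanSpace ℝ (Fin d) →ᵈ EuclideanSpace ℝ (Fin d), piece w = S '' P.J
  child_subset : ∀ (w : P.Word) (i : Fin (P.num w.length)), piece (w.child i) ⊆ piece w
  disjoint_interior : ∀ (w : P.Word) (i j : Fin (P.num w.length)), i ≠ j →
    interior (piece (w.child i)) ∩ interior (piece (w.child j)) = ∅
  diam_child : ∀ (w : P.Word) (i : Fin (P.num w.length)),
    Metric.diam (piece (w.child i)) / Metric.diam (piece w) = P.ratio w.length

/-! ### Hyperbolic graphs and their boundaries -/

section Hyperbolic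

variable {V : Type*} (G : SimpleGraph V) (o : V)

/-- The Gromov product `|x ∧ y| = (|x| + |y| - d(x, y)) / 2` with respect to the root `o`. -/
noncomputable def gromovProduct (x y : V) : ℝ :=
  ((G.dist o x : ℝ) + (G.dist o y : ℝ) - (G.dist x y : ℝ)) / 2

/-- The graph is hyperbolic with constant `δ` with respect to the root `o`. -/
def IsHyperbolicWith (δ : ℝ) : Prop :=
  ∀ x y z : V,
    min (gromovProduct G o x z) (gromovProduct G o z y) - δ ≤ gromovProduct G o x y

/-- A graph is hyperbolic with respect to `o` if it is so with some constant `δ > 0`. -/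
def IsHyperbolicGraph : Prop := ∃ δ : ℝ, 0 < δ ∧ IsHyperbolicWith G o δ

/-- The parameters `a > 0` for which `ρ_a` is defined: `exp (δ a) - 1 < √2 - 1` for some constant of
hyperbolicity `δ > 0`. -/
def IsHyperbolicParameter (a : ℝ) : Prop :=
  0 < a ∧ ∃ δ : ℝ, 0 < δ ∧ IsHyperbolicWith G o δ ∧ Real.exp (δ * a) - 1 < √2 - 1

open Classical in
/-- `ρ_a(x, y) = exp (-a |x ∧ y|)` for `x ≠ y`, and `ρ_a(x, x) = 0`. -/
noncomputable def hyperbolicRho (a : ℝ) (x y : V) : NNReal :=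
  if x = y then 0 else (Real.exp (-a * gromovProduct G o x y)).toNNReal

theorem hyperbolicRho_self (a : ℝ) (x : V) : hyperbolicRho G o a x x = 0 := by
  simp [hyperbolicRho]

theorem gromovProduct_comm (x y : V) : gromovProduct G o x y = gromovProduct G o y x := by
  unfold gromovProduct
  rw [G.dist_comm (u := x) (v := y)]
  ring

theorem hyperbolicRho_comm (a : ℝ) (x y : V) :
    hyperbolicRho G o a x y = hyperbolicRho G o a y x := by
  unfold hyperbolicRho
  rw [gromovProduct_comm G o x y]
  by_cases h : x = y
  · rw [if_pos h, if_pos h.symm]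
  · rw [if_neg h, if_neg (Ne.symm h)]

/-- The vertex set `V`, to be equipped with the hyperbolic metric of parameter `a`. -/
def HyperbolicSpace {V : Type*} (_G : SimpleGraph V) (_o : V) (_a : ℝ) : Type _ := V

/-- `ρ_a` itself need not satisfy the triangle inequality.  The metric on `V` is the largest
pseudometric below `ρ_a`, namely the infimum of `∑ ρ_a(x_i, x_{i+1})` over all finite chains.  It
lies between `ρ_a / 2` and `ρ_a` when `a` is a hyperbolic parameter: see the two facts below. -/
noncomputable instance HyperbolicSpace.instPseudoMetricSpace (a : ℝ) :
    PseudoMetricSpace (HyperbolicSpace G o a) :=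
  PseudoMetricSpace.ofPreNNDist (X := V) (hyperbolicRho G o a) (hyperbolicRho_self G o a)
    (hyperbolicRho_comm G o a)

theorem HyperbolicSpace.dist_le_rho (a : ℝ) (x y : HyperbolicSpace G o a) :
    dist x y ≤ hyperbolicRho G o a x y :=
  PseudoMetricSpace.dist_ofPreNNDist_le (X := V) _ (hyperbolicRho_self G o a)
    (hyperbolicRho_comm G o a) x y

theorem HyperbolicSpace.rho_le_two_mul_dist {a : ℝ} (ha : IsHyperbolicParameter G o a)
    (x y : HyperbolicSpace G o a) :
    (hyperbolicRho G o a x y : ℝ) ≤ 2 * dist x y := by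
  obtain ⟨ha0, δ, hδ, hyp, hlt⟩ := ha
  have hone : 1 ≤ Real.exp (δ * a) := Real.one_le_exp (by positivity)
  have hsq : Real.exp (δ * a) * Real.exp (δ * a) ≤ 2 := by
    have h1 : Real.exp (δ * a) ≤ √2 := by linarith
    nlinarith [Real.mul_self_sqrt (show (0 : ℝ) ≤ 2 by norm_num), Real.exp_pos (δ * a)]
  have key : ∀ u v w : V, (hyperbolicRho G o a u v : ℝ) ≤
      Real.exp (δ * a) * max (hyperbolicRho G o a u w : ℝ) (hyperbolicRho G o a w v : ℝ) := by
    intro u v w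
    by_cases huv : u = v
    · subst huv
      rw [hyperbolicRho_self]
      positivity
    by_cases huw : u = w
    · subst huw
      rw [hyperbolicRho_self, NNReal.coe_zero, max_eq_right (NNReal.coe_nonneg _)]
      exact le_mul_of_one_le_left (NNReal.coe_nonneg _) hone
    by_cases hwv : w = v
    · subst hwv
      rw [hyperbolicRho_self, NNReal.coe_zero, max_eq_left (NNReal.coe_nonneg _)]
      exact le_mul_of_one_le_left (NNReal.coe_nonneg _) hone
    simp only [hyperbolicRho, huv, huw, hwv, if_false, Real.coe_toNNReal _ (Real.exp_pos _).le]
    have h := hyp u v w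
    rcases min_le_iff.mp (show min (gromovProduct G o u w) (gromovProduct G o w v)
        ≤ gromovProduct G o u v + δ by linarith) with h1 | h1
    · refine le_trans ?_ (mul_le_mul_of_nonneg_left (le_max_left _ _) (Real.exp_pos _).le)
      rw [← Real.exp_add]
      exact Real.exp_le_exp.mpr (by nlinarith)
    · refine le_trans ?_ (mul_le_mul_of_nonneg_left (le_max_right _ _) (Real.exp_pos _).le)
      rw [← Real.exp_add]
      exact Real.exp_le_exp.mpr (by nlinarith)
  refine PseudoMetricSpace.le_two_mul_dist_ofPreNNDist (X := V) _ (hyperbolicRho_self G o a)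
    (hyperbolicRho_comm G o a) ?_ x y
  intro x₁ x₂ x₃ x₄
  rw [← NNReal.coe_le_coe]
  push_cast
  set M := max (hyperbolicRho G o a x₁ x₂ : ℝ)
    (max (hyperbolicRho G o a x₂ x₃ : ℝ) (hyperbolicRho G o a x₃ x₄ : ℝ)) with hM
  have hM0 : 0 ≤ M := le_max_of_le_left (NNReal.coe_nonneg _)
  have hA : max (hyperbolicRho G o a x₂ x₃ : ℝ) (hyperbolicRho G o a x₃ x₄ : ℝ) ≤ M :=
    le_max_right _ _
  have hB : (hyperbolicRho G o a x₁ x₂ : ℝ) ≤ M := le_max_left _ _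
  have hC : (hyperbolicRho G o a x₂ x₄ : ℝ) ≤ Real.exp (δ * a) * M :=
    (key x₂ x₄ x₃).trans (mul_le_mul_of_nonneg_left hA (Real.exp_pos _).le)
  calc (hyperbolicRho G o a x₁ x₄ : ℝ)
      ≤ Real.exp (δ * a) *
          max (hyperbolicRho G o a x₁ x₂ : ℝ) (hyperbolicRho G o a x₂ x₄ : ℝ) := key x₁ x₄ x₂
    _ ≤ Real.exp (δ * a) * (Real.exp (δ * a) * M) := by
        refine mul_le_mul_of_nonneg_left (max_le ?_ hC) (Real.exp_pos _).le
        exact hB.trans (le_mul_of_one_le_left hM0 hone)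
    _ = Real.exp (δ * a) * Real.exp (δ * a) * M := by ring
    _ ≤ 2 * M := mul_le_mul_of_nonneg_right hsq hM0

/-- The hyperbolic boundary: the points of the completion that do not come from a vertex, with the
metric of the completion. -/
abbrev HyperbolicBoundary (a : ℝ) : Type _ :=
  {ξ : UniformSpace.Completion (HyperbolicSpace G o a) //
    ξ ∉ Set.range ((↑) : HyperbolicSpace G o a → UniformSpace.Completion (HyperbolicSpace G o a))}

end Hyperbolic

/-- Lipschitz equivalence: there is a bi-Lipschitz bijection. -/
def LipschitzEquivalent (A B : Type*) [MetricSpace A] [MetricSpace B] : Prop :=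
  ∃ σ : A ≃ B, ∃ C : ℝ, 0 < C ∧
    ∀ x y : A, C⁻¹ * dist x y ≤ dist (σ x) (σ y) ∧ dist (σ x) (σ y) ≤ C * dist x y

namespace MoranStructure

variable {d : ℕ} {P : MoranParameters d} (F : MoranStructure P)

/-- The Moran set `E`: the intersection over `k` of the unions of the `J_w`, `w ∈ D_k`. -/
def moranSet : Set (EuclideanSpace ℝ (Fin d)) :=
  ⋂ k : ℕ, ⋃ w ∈ {w : P.Word | w.length = k}, F.piece w

/-- The horizontal edges join distinct words `u, v` of one level `X_n`, `n > 0`, with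
`J_u ∩ J_v ≠ ∅`. -/
def horizontalGraph : SimpleGraph P.Vertex :=
  SimpleGraph.fromRel fun u v =>
    ∃ n, 0 < n ∧ u.1 ∈ P.level n ∧ v.1 ∈ P.level n ∧ (F.piece u.1 ∩ F.piece v.1).Nonempty

/-- The augmented tree induced by the Moran structure. -/
def augmentedTree : SimpleGraph P.Vertex := P.verticalGraph ⊔ F.horizontalGraph

/-- Condition (H). -/
def ConditionH : Prop :=
  ∃ C : ℝ, 0 < C ∧ ∀ n : ℕ, 1 ≤ n → ∀ u ∈ P.level n, ∀ v ∈ P.level n,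
    (F.piece u ∩ F.piece v).Nonempty ∨
      ∀ x ∈ F.piece u, ∀ y ∈ F.piece v, C * P.r ^ n ≤ dist x y

/-- The hyperbolic boundary `∂X` of the augmented tree, with the hyperbolic metric of
parameter `a`. -/
abbrev Boundary (a : ℝ) : Type _ := HyperbolicBoundary F.augmentedTree P.root a

end MoranStructure

/-! The vertex `v` at level `n` is treated as a ball of radius about `r ^ n` around a point of its
piece. For vertices `x`, `y` let the size be `r ^ |x| + r ^ |y| + dist (pt x) (pt y)`. Everything
rests on one comparison: the size equals `r ^ |x ∧ y|` up to constant factors. In one direction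
(`size_le`) a geodesic from `x` to `y` is cut near its turning point and the lengths of its edges in
the metric space are summed as a geometric series. In the other (`rpow_le_size`) two vertices that
are close on the scale `r ^ m` have equal or adjacent ancestors at level `m`; this is where
condition (H) enters.

Since the size satisfies the triangle inequality, taking logarithms gives hyperbolicity. With `α = a
/ -log r` one has `ρ_a = (r ^ |x ∧ y|) ^ α` off the diagonal, so the hyperbolic metric is comparable
to the size to the power `α` for distinct vertices. Along sequences of levels tending to infinity
the size tends to a distance between points of the set, so the boundary is a Hölder copy of the
Moran set with exponent `α` (`exists_equiv_boundary`). This exponent depends only on `a` and `r`,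
which both families share, so bi-Lipschitz maps between the Moran sets correspond to bi-Lipschitz
maps between the boundaries (`LipschitzEquivalent.of_holder`). -/

open Filter Topology

/-! ### Graphs approximating a set -/

/-- A graph `G` with root `o` approximating a set `E` in a metric space: the vertex `v` stands for
the ball of radius about `r ^ level v` around `pt v`, and adjacency means proximity on that scale. -/
structure GraphApproximation {V M : Type*} [MetricSpace M] (G : SimpleGraph V) (o : V)
    (E : Set M) (r : ℝ) where
  level : V → ℕ
  pt : V → M
  C : ℝ
  r_pos : 0 < r
  r_lt_one : r < 1
  one_le_C : 1 ≤ C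
  level_root : level o = 0
  level_le_of_adj : ∀ {u v}, G.Adj u v → level v ≤ level u + 1
  dist_le_of_adj : ∀ {u v}, G.Adj u v → dist (pt u) (pt v) ≤ C * (r ^ level u + r ^ level v)
  exists_walk_root : ∀ x, ∃ W : G.Walk o x, W.length ≤ level x
  exists_walk : ∀ x y m, m ≤ level x → m ≤ level y → C * dist (pt x) (pt y) < r ^ m →
    ∃ W : G.Walk x y, W.length + 2 * m ≤ level x + level y + 1
  exists_near : ∀ e ∈ E, ∀ n, ∃ v, level v = n ∧ dist (pt v) e ≤ C * r ^ n
  mem_of_tendsto : ∀ (x : ℕ → V) (e : M), Tendsto (fun n => level (x n)) atTop atTop →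
    Tendsto (fun n => pt (x n)) atTop (𝓝 e) → e ∈ E

/-! ### The Gromov product and the size of a pair; hyperbolicity -/

namespace GraphApproximation

variable {V M : Type*} [MetricSpace M] {G : SimpleGraph V} {o : V} {E : Set M} {r : ℝ}
  (A : GraphApproximation G o E r)

theorem C_pos : 0 < A.C := zero_lt_one.trans_le A.one_le_C

theorem connected (A : GraphApproximation G o E r) : G.Connected := by
  have h : ∀ x, G.Reachable o x := fun x => (A.exists_walk_root x).choose.reachable
  exact { preconnected := fun x y => (h x).symm.trans (h y), nonempty := ⟨o⟩ }

theorem level_le_add_length {x y : V} (W : G.Walk x y) : A.level y ≤ A.level x + W.length := by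
  induction W with
  | nil => simp
  | cons h W ih =>
    have := A.level_le_of_adj h
    rw [SimpleGraph.Walk.length_cons]
    omega

theorem dist_root (x : V) : G.dist o x = A.level x := by
  obtain ⟨W, hW⟩ := A.exists_walk_root x
  apply le_antisymm ((SimpleGraph.dist_le W).trans hW)
  obtain ⟨W', hW'⟩ := A.connected.exists_walk_length_eq_dist o x
  have := A.level_le_add_length W'
  rw [A.level_root] at this
  omega

theorem gromovProduct_eq (x y : V) :
    gromovProduct G o x y = ((A.level x : ℝ) + A.level y - G.dist x y) / 2 := by
  rw [gromovProduct, A.dist_root, A.dist_root]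

theorem gromovProduct_nonneg (A : GraphApproximation G o E r) (x y : V) : 0 ≤ gromovProduct G o x y := by
  have h := A.connected.dist_triangle (u := x) (v := o) (w := y)
  rw [G.dist_comm (u := x) (v := o)] at h
  have h' : (G.dist x y : ℝ) ≤ G.dist o x + G.dist o y := by exact_mod_cast h
  unfold gromovProduct
  linarith

theorem gromovProduct_le_left (x y : V) : gromovProduct G o x y ≤ A.level x := by
  have h := A.connected.dist_triangle (u := o) (v := x) (w := y)
  rw [A.dist_root, A.dist_root] at h
  have h' : (A.level y : ℝ) ≤ A.level x + G.dist x y := by exact_mod_cast h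
  rw [A.gromovProduct_eq]
  linarith

theorem gromovProduct_le_right (x y : V) : gromovProduct G o x y ≤ A.level y := by
  rw [gromovProduct_comm]
  exact A.gromovProduct_le_left y x

/-- A vertex `j` steps before `z` has level at least `level z - j`, so the edges contribute a
geometric series dominated by the term farthest from `z`. The constant `K = 2C / (1 - r)` solves `2C
+ r K = K`, which closes the induction. -/
theorem dist_le_of_walk {x z : V} (W : G.Walk x z) :
    dist (A.pt x) (A.pt z) ≤ 2 * A.C / (1 - r) * r ^ ((A.level z : ℝ) - W.length) := by
  have hr := A.r_pos
  have hr1 : 0 < 1 - r := sub_pos.mpr A.r_lt_one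
  have hC := A.C_pos
  induction W with
  | nil => rw [dist_self]; positivity
  | @cons x x' z h W ih =>
    have h1 : A.level z ≤ A.level x' + W.length := A.level_le_add_length W
    have h2 : A.level x' ≤ A.level x + 1 := A.level_le_of_adj h
    have h1' : (A.level z : ℝ) ≤ A.level x' + W.length := by exact_mod_cast h1
    have h2' : (A.level x' : ℝ) ≤ A.level x + 1 := by exact_mod_cast h2
    rw [SimpleGraph.Walk.length_cons]
    push_cast
    set t : ℝ := (A.level z : ℝ) - (W.length + 1) with ht
    have e1 : r ^ A.level x ≤ r ^ t := by
      rw [← Real.rpow_natCast]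
      exact Real.rpow_le_rpow_of_exponent_ge hr A.r_lt_one.le (by linarith)
    have e2 : r ^ A.level x' ≤ r ^ t := by
      rw [← Real.rpow_natCast]
      exact Real.rpow_le_rpow_of_exponent_ge hr A.r_lt_one.le (by linarith)
    have e3 : r ^ ((A.level z : ℝ) - W.length) = r * r ^ t := by
      rw [show (A.level z : ℝ) - W.length = 1 + t by rw [ht]; ring, Real.rpow_add hr,
        Real.rpow_one]
    rw [e3] at ih
    calc dist (A.pt x) (A.pt z) ≤ dist (A.pt x) (A.pt x') + dist (A.pt x') (A.pt z) :=
          dist_triangle _ _ _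
      _ ≤ A.C * (r ^ t + r ^ t) + 2 * A.C / (1 - r) * (r * r ^ t) := by
          refine add_le_add ((A.dist_le_of_adj h).trans ?_) ih
          gcongr
      _ = 2 * A.C / (1 - r) * r ^ t := by
          field_simp
          ring

theorem dist_le_rpow (x y : V) :
    dist (A.pt x) (A.pt y) ≤ 2 * A.C / (1 - r) * (1 + r⁻¹) * r ^ gromovProduct G o x y := by
  have hr := A.r_pos
  have hr1 : 0 < 1 - r := sub_pos.mpr A.r_lt_one
  have hC := A.C_pos
  obtain ⟨W, hW⟩ := A.connected.exists_walk_length_eq_dist x y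
  have h1 := A.level_le_add_length W
  have h2 := A.level_le_add_length W.reverse
  rw [SimpleGraph.Walk.length_reverse] at h2
  -- The turning point of the geodesic: `level x - k` and `level y - (W.length - k)` both equal `|x
  -- ∧ y|` up to rounding. The division rounds down, which costs at most `1/2` in the second
  -- exponent; the factor `r⁻¹` absorbs it.
  obtain ⟨k, hk⟩ : ∃ k, k = (A.level x + W.length - A.level y) / 2 := ⟨_, rfl⟩
  have hkL : k ≤ W.length := by omega
  have b1 := A.dist_le_of_walk (W.take k).reverse
  have b2 := A.dist_le_of_walk (W.drop k)
  rw [SimpleGraph.Walk.length_reverse, SimpleGraph.Walk.take_length, min_eq_left hkL] at b1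
  rw [SimpleGraph.Walk.drop_length, Nat.cast_sub hkL] at b2
  rw [dist_comm] at b1
  have k1 : (2 * k : ℝ) + A.level y ≤ A.level x + W.length := by
    have : 2 * k + A.level y ≤ A.level x + W.length := by omega
    exact_mod_cast this
  have k2 : (A.level x + W.length : ℝ) ≤ 2 * k + A.level y + 1 := by
    have : A.level x + W.length ≤ 2 * k + A.level y + 1 := by omega
    exact_mod_cast this
  have hg := A.gromovProduct_eq x y
  rw [← hW] at hg
  have c1 : r ^ ((A.level x : ℝ) - k) ≤ r ^ gromovProduct G o x y :=
    Real.rpow_le_rpow_of_exponent_ge hr A.r_lt_one.le (by linarith)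
  have c2 : r ^ ((A.level y : ℝ) - (W.length - k)) ≤ r⁻¹ * r ^ gromovProduct G o x y := by
    rw [← Real.rpow_neg_one, ← Real.rpow_add hr]
    exact Real.rpow_le_rpow_of_exponent_ge hr A.r_lt_one.le (by linarith)
  calc dist (A.pt x) (A.pt y)
      ≤ dist (A.pt x) (A.pt (W.getVert k)) + dist (A.pt (W.getVert k)) (A.pt y) :=
        dist_triangle _ _ _
    _ ≤ 2 * A.C / (1 - r) * r ^ gromovProduct G o x y
        + 2 * A.C / (1 - r) * (r⁻¹ * r ^ gromovProduct G o x y) := by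
        refine add_le_add (b1.trans ?_) (b2.trans ?_) <;> gcongr
    _ = _ := by ring

/-- The size of the pair `x`, `y`: it is comparable to `r ^ |x ∧ y|`. -/
noncomputable def size (x y : V) : ℝ := r ^ A.level x + r ^ A.level y + dist (A.pt x) (A.pt y)

theorem size_pos (x y : V) : 0 < A.size x y := by
  have := A.r_pos
  unfold size
  positivity

theorem size_le (x y : V) : A.size x y ≤
    (2 + 2 * A.C / (1 - r) * (1 + r⁻¹)) * r ^ gromovProduct G o x y := by
  have h1 : r ^ A.level x ≤ r ^ gromovProduct G o x y := by
    rw [← Real.rpow_natCast]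
    exact Real.rpow_le_rpow_of_exponent_ge A.r_pos A.r_lt_one.le (A.gromovProduct_le_left x y)
  have h2 : r ^ A.level y ≤ r ^ gromovProduct G o x y := by
    rw [← Real.rpow_natCast]
    exact Real.rpow_le_rpow_of_exponent_ge A.r_pos A.r_lt_one.le (A.gromovProduct_le_right x y)
  have h3 := A.dist_le_rpow x y
  unfold size
  linarith

theorem size_triangle (x y z : V) : A.size x y ≤ A.size x z + A.size z y := by
  have h := dist_triangle (A.pt x) (A.pt z) (A.pt y)
  have := pow_pos A.r_pos (A.level z)
  unfold size
  linarith

/-- If `m` is the scale with `r ^ (m + 1) < C * size ≤ r ^ m`, both levels are at least `m` and the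
points are close enough for `exists_walk`. The resulting walk passes through level `m` and forces
`|x ∧ y| ≥ m - 1/2`. -/
theorem rpow_le_size (x y : V) :
    r ^ gromovProduct G o x y ≤ A.C * r⁻¹ * r⁻¹ * A.size x y := by
  have hr := A.r_pos
  have hC := A.C_pos
  have hri : 1 ≤ r⁻¹ := (one_le_inv₀ hr).mpr A.r_lt_one.le
  have hs := A.size_pos x y
  -- A large size admits no such scale `m`, but then `|x ∧ y| ≥ 0` is enough.
  rcases le_or_gt 1 (A.C * A.size x y) with h | h
  · have h0 : r ^ gromovProduct G o x y ≤ 1 :=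
      Real.rpow_le_one hr.le A.r_lt_one.le (A.gromovProduct_nonneg x y)
    have h1 : 1 ≤ r⁻¹ * r⁻¹ := one_le_mul_of_one_le_of_one_le hri hri
    calc _ ≤ 1 := h0
      _ ≤ 1 * (A.C * A.size x y) := by linarith
      _ ≤ r⁻¹ * r⁻¹ * (A.C * A.size x y) := by gcongr
      _ = _ := by ring
  · obtain ⟨m, hm1, hm2⟩ := exists_nat_pow_near_of_lt_one (mul_pos hC hs) h.le hr A.r_lt_one
    have hsC : A.size x y ≤ A.C * A.size x y := le_mul_of_one_le_left hs.le A.one_le_C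
    have hx : m ≤ A.level x := by
      refine ((pow_lt_pow_iff_right_of_lt_one₀ hr A.r_lt_one).mp ?_).le
      have := pow_pos hr (A.level y)
      have := dist_nonneg (x := A.pt x) (y := A.pt y)
      unfold size at hsC hm2
      linarith
    have hy : m ≤ A.level y := by
      refine ((pow_lt_pow_iff_right_of_lt_one₀ hr A.r_lt_one).mp ?_).le
      have := pow_pos hr (A.level x)
      have := dist_nonneg (x := A.pt x) (y := A.pt y)
      unfold size at hsC hm2
      linarith
    have hd : A.C * dist (A.pt x) (A.pt y) < r ^ m := by
      refine lt_of_lt_of_le (mul_lt_mul_of_pos_left ?_ hC) hm2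
      have := pow_pos hr (A.level x)
      have := pow_pos hr (A.level y)
      unfold size
      linarith
    obtain ⟨W, hW⟩ := A.exists_walk x y m hx hy hd
    have hL : G.dist x y + 2 * m ≤ A.level x + A.level y + 1 :=
      (Nat.add_le_add_right (SimpleGraph.dist_le W) _).trans hW
    have hL' : (G.dist x y : ℝ) + 2 * m ≤ A.level x + A.level y + 1 := by exact_mod_cast hL
    have hg := A.gromovProduct_eq x y
    calc r ^ gromovProduct G o x y ≤ r ^ ((-1 : ℝ) + (-1) + (m + 1 : ℕ)) := by
          refine Real.rpow_le_rpow_of_exponent_ge hr A.r_lt_one.le ?_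
          push_cast
          linarith
      _ = r⁻¹ * r⁻¹ * r ^ (m + 1) := by
          rw [Real.rpow_add hr, Real.rpow_add hr, Real.rpow_neg_one, Real.rpow_natCast]
      _ ≤ r⁻¹ * r⁻¹ * (A.C * A.size x y) := by gcongr
      _ = _ := by ring

theorem isHyperbolicGraph (A : GraphApproximation G o E r) : IsHyperbolicGraph G o := by
  have hr := A.r_pos
  have hr1 : 0 < 1 - r := sub_pos.mpr A.r_lt_one
  have hC := A.C_pos
  obtain ⟨K, hK⟩ : ∃ K, K = A.C * r⁻¹ * r⁻¹ * (2 * (2 + 2 * A.C / (1 - r) * (1 + r⁻¹))) :=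
    ⟨_, rfl⟩
  have hKpos : 0 < K := by rw [hK]; positivity
  have hlog : Real.log r < 0 := Real.log_neg hr A.r_lt_one
  -- `δ` is chosen so that `r ^ (-δ) = K + 1`; the summand `1` makes it positive.
  refine ⟨Real.log (K + 1) / -Real.log r,
    div_pos (Real.log_pos (by linarith)) (neg_pos.mpr hlog), fun x y z => ?_⟩
  set δ := Real.log (K + 1) / -Real.log r with hδ
  set μ := min (gromovProduct G o x z) (gromovProduct G o z y) with hμ
  have hrδ : r ^ (-δ) = K + 1 := by
    rw [Real.rpow_def_of_pos hr, hδ, show Real.log r * -(Real.log (K + 1) / -Real.log r)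
      = Real.log (K + 1) by have := hlog.ne; field_simp, Real.exp_log (by linarith)]
  have m1 : r ^ gromovProduct G o x z ≤ r ^ μ :=
    Real.rpow_le_rpow_of_exponent_ge hr A.r_lt_one.le (min_le_left _ _)
  have m2 : r ^ gromovProduct G o z y ≤ r ^ μ :=
    Real.rpow_le_rpow_of_exponent_ge hr A.r_lt_one.le (min_le_right _ _)
  have hle : r ^ gromovProduct G o x y ≤ r ^ (μ - δ) := by
    calc r ^ gromovProduct G o x y ≤ A.C * r⁻¹ * r⁻¹ * A.size x y := A.rpow_le_size x y
      _ ≤ A.C * r⁻¹ * r⁻¹ * (A.size x z + A.size z y) := by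
          gcongr
          exact A.size_triangle x y z
      _ ≤ A.C * r⁻¹ * r⁻¹ * ((2 + 2 * A.C / (1 - r) * (1 + r⁻¹)) * r ^ μ
            + (2 + 2 * A.C / (1 - r) * (1 + r⁻¹)) * r ^ μ) := by
          gcongr
          · exact (A.size_le x z).trans (by gcongr)
          · exact (A.size_le z y).trans (by gcongr)
      _ = K * r ^ μ := by rw [hK]; ring
      _ ≤ (K + 1) * r ^ μ := by gcongr; linarith
      _ = r ^ (μ - δ) := by rw [sub_eq_add_neg, Real.rpow_add hr, hrδ]; ring
  exact (Real.rpow_le_rpow_left_iff_of_base_lt_one hr A.r_lt_one).mp hle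

end GraphApproximation

/-! ### The hyperbolic boundary of an approximating graph -/

namespace GraphApproximation

variable {V M : Type*} [MetricSpace M] {G : SimpleGraph V} {o : V} {E : Set M} {r : ℝ}
  (A : GraphApproximation G o E r)

theorem exponent_pos (A : GraphApproximation G o E r) {a : ℝ} (ha : 0 < a) :
    0 < a / -Real.log r :=
  div_pos ha (neg_pos.mpr (Real.log_neg A.r_pos A.r_lt_one))

theorem hyperbolicRho_eq (A : GraphApproximation G o E r) (a : ℝ) {x y : V} (h : x ≠ y) :
    (hyperbolicRho G o a x y : ℝ) = (r ^ gromovProduct G o x y) ^ (a / -Real.log r) := by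
  have hlog : Real.log r ≠ 0 := (Real.log_neg A.r_pos A.r_lt_one).ne
  rw [hyperbolicRho, if_neg h, Real.coe_toNNReal _ (Real.exp_pos _).le, ← Real.rpow_mul A.r_pos.le,
    Real.rpow_def_of_pos A.r_pos]
  congr 1
  field_simp

theorem exists_dist_le_size {a : ℝ} (ha : 0 < a) : ∃ K : ℝ, 0 < K ∧
    ∀ x y : HyperbolicSpace G o a, dist x y ≤ K * A.size x y ^ (a / -Real.log r) := by
  have hr := A.r_pos
  have hC := A.C_pos
  have hα := A.exponent_pos ha
  refine ⟨(A.C * r⁻¹ * r⁻¹) ^ (a / -Real.log r), by positivity, fun x y => ?_⟩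
  have hs := A.size_pos x y
  rw [← Real.mul_rpow (by positivity) hs.le]
  by_cases h : x = y
  · rw [h, dist_self]
    have := A.size_pos y y
    positivity
  · refine (HyperbolicSpace.dist_le_rho G o a x y).trans ?_
    rw [A.hyperbolicRho_eq a h]
    exact Real.rpow_le_rpow (Real.rpow_pos_of_pos hr _).le (A.rpow_le_size x y) hα.le

/-- Only the distance of the points is bounded, not the full size, because the size of a vertex with
itself is positive. The two powers of `r` disappear in the limit anyway. -/
theorem exists_dist_pt_le {a : ℝ} (ha : IsHyperbolicParameter G o a) : ∃ K : ℝ, 0 < K ∧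
    ∀ x y : HyperbolicSpace G o a,
      dist (A.pt x) (A.pt y) ^ (a / -Real.log r) ≤ K * dist x y := by
  have hr := A.r_pos
  have hr1 : 0 < 1 - r := sub_pos.mpr A.r_lt_one
  have hC := A.C_pos
  have hα := A.exponent_pos ha.1
  refine ⟨(2 * A.C / (1 - r) * (1 + r⁻¹)) ^ (a / -Real.log r) * 2, by positivity, fun x y => ?_⟩
  by_cases h : x = y
  · rw [h, dist_self, dist_self, Real.zero_rpow hα.ne', mul_zero]
  · calc dist (A.pt x) (A.pt y) ^ (a / -Real.log r)
        ≤ (2 * A.C / (1 - r) * (1 + r⁻¹) * r ^ gromovProduct G o x y) ^ (a / -Real.log r) :=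
          Real.rpow_le_rpow dist_nonneg (A.dist_le_rpow x y) hα.le
      _ = (2 * A.C / (1 - r) * (1 + r⁻¹)) ^ (a / -Real.log r) * hyperbolicRho G o a x y := by
          rw [Real.mul_rpow (by positivity) (by positivity), A.hyperbolicRho_eq a h]
      _ ≤ (2 * A.C / (1 - r) * (1 + r⁻¹)) ^ (a / -Real.log r) * (2 * dist x y) := by
          gcongr
          exact HyperbolicSpace.rho_le_two_mul_dist G o ha x y
      _ = _ := by ring

/-- Since `|x ∧ y| ≤ |x|`, every vertex is isolated, uniformly so among vertices of bounded level.
This separates the boundary from the vertices. -/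
theorem pow_level_le_dist {a : ℝ} (ha : IsHyperbolicParameter G o a)
    {x y : HyperbolicSpace G o a} (h : x ≠ y) :
    (r ^ A.level x) ^ (a / -Real.log r) ≤ 2 * dist x y := by
  refine le_trans ?_ (HyperbolicSpace.rho_le_two_mul_dist G o ha x y)
  rw [A.hyperbolicRho_eq a h]
  refine Real.rpow_le_rpow (pow_pos A.r_pos _).le ?_ (A.exponent_pos ha.1).le
  rw [← Real.rpow_natCast]
  exact Real.rpow_le_rpow_of_exponent_ge A.r_pos A.r_lt_one.le (A.gromovProduct_le_left x y)

theorem tendsto_size {ι : Type*} {l : Filter ι} {f g : ι → V} {e e' : M}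
    (hf : Tendsto (fun i => A.level (f i)) l atTop) (hg : Tendsto (fun i => A.level (g i)) l atTop)
    (hfe : Tendsto (fun i => A.pt (f i)) l (𝓝 e)) (hge : Tendsto (fun i => A.pt (g i)) l (𝓝 e')) :
    Tendsto (fun i => A.size (f i) (g i)) l (𝓝 (dist e e')) := by
  have h0 := tendsto_pow_atTop_nhds_zero_of_lt_one A.r_pos.le A.r_lt_one
  simpa [size] using ((h0.comp hf).add (h0.comp hg)).add (hfe.dist hge)

theorem tendsto_dist_zero {a : ℝ} (ha : 0 < a) {ι : Type*} {l : Filter ι}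
    {f g : ι → HyperbolicSpace G o a} {e : M}
    (hf : Tendsto (fun i => A.level (f i)) l atTop) (hg : Tendsto (fun i => A.level (g i)) l atTop)
    (hfe : Tendsto (fun i => A.pt (f i)) l (𝓝 e)) (hge : Tendsto (fun i => A.pt (g i)) l (𝓝 e)) :
    Tendsto (fun i => dist (f i) (g i)) l (𝓝 0) := by
  obtain ⟨K, hK, h⟩ := A.exists_dist_le_size ha
  have hα := A.exponent_pos ha
  refine squeeze_zero (fun _ => dist_nonneg) (fun i => h (f i) (g i)) ?_
  have := ((A.tendsto_size hf hg hfe hge).rpow_const (p := a / -Real.log r)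
    (Or.inr hα.le)).const_mul K
  simpa [dist_self, Real.zero_rpow hα.ne'] using this

theorem exists_seq (A : GraphApproximation G o E r) (a : ℝ) {e : M} (he : e ∈ E) :
    ∃ x : ℕ → HyperbolicSpace G o a,
      Tendsto (fun n => A.level (x n)) atTop atTop ∧
        Tendsto (fun n => A.pt (x n)) atTop (𝓝 e) := by
  choose w hw hwe using A.exists_near e he
  refine ⟨w, ?_, ?_⟩
  · exact tendsto_id.congr fun n => (hw n).symm
  · rw [tendsto_iff_dist_tendsto_zero]
    refine squeeze_zero (fun _ => dist_nonneg) hwe ?_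
    simpa using (tendsto_pow_atTop_nhds_zero_of_lt_one A.r_pos.le A.r_lt_one).const_mul A.C

/-- A sequence of vertices of unbounded level whose points tend to `e` converges in the hyperbolic
completion to a boundary point that depends on `e` only. -/
theorem exists_boundary_limit {a : ℝ} (ha : IsHyperbolicParameter G o a) {e : M} (he : e ∈ E) :
    ∃ ξ : HyperbolicBoundary G o a, ∀ x : ℕ → HyperbolicSpace G o a,
      Tendsto (fun n => A.level (x n)) atTop atTop → Tendsto (fun n => A.pt (x n)) atTop (𝓝 e) →
      Tendsto (fun n => (x n : UniformSpace.Completion (HyperbolicSpace G o a))) atTop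
        (𝓝 ξ.1) := by
  obtain ⟨w, hlw, hpw⟩ := A.exists_seq a he
  have hcau : CauchySeq w := by
    rw [cauchySeq_iff_tendsto_dist_atTop_0, ← prod_atTop_atTop_eq]
    exact A.tendsto_dist_zero ha.1 (hlw.comp tendsto_fst) (hlw.comp tendsto_snd)
      (hpw.comp tendsto_fst) (hpw.comp tendsto_snd)
  obtain ⟨ξ, hξ⟩ := cauchySeq_tendsto_of_complete
    ((UniformSpace.Completion.uniformContinuous_coe _).comp_cauchySeq hcau)
  refine ⟨⟨ξ, ?_⟩, fun x hx hxe => ?_⟩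
  -- The limit is not a vertex `v`: terms of level above that of `v` differ from `v`, hence stay at
  -- a definite distance from it.
  · rintro ⟨v, rfl⟩
    have h1 : Tendsto (fun n => 2 * dist v (w n)) atTop (𝓝 0) := by
      have := (tendsto_iff_dist_tendsto_zero.mp hξ).const_mul 2
      simpa [UniformSpace.Completion.dist_eq, dist_comm] using this
    have hpos : 0 < (r ^ A.level v) ^ (a / -Real.log r) :=
      Real.rpow_pos_of_pos (pow_pos A.r_pos _) _
    obtain ⟨n, hn1, hn2⟩ := ((h1.eventually_lt_const hpos).and
      (hlw.eventually_gt_atTop (A.level v))).exists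
    have hne : v ≠ w n := by
      rintro rfl
      exact lt_irrefl _ hn2
    exact absurd (A.pow_level_le_dist ha hne) (not_le.mpr hn1)
  · refine (tendsto_iff_of_dist ?_).mp hξ
    simpa [UniformSpace.Completion.dist_eq] using A.tendsto_dist_zero ha.1 hlw hx hpw hxe

/-- If some level bound held infinitely often, the uniform isolation of such vertices would make the
Cauchy sequence eventually constant, and its limit would be a vertex. -/
theorem tendsto_level {a : ℝ} (ha : IsHyperbolicParameter G o a) (ξ : HyperbolicBoundary G o a)
    {x : ℕ → HyperbolicSpace G o a}
    (hx : Tendsto (fun n => (x n : UniformSpace.Completion (HyperbolicSpace G o a))) atTop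
      (𝓝 ξ.1)) : Tendsto (fun n => A.level (x n)) atTop atTop := by
  rw [tendsto_atTop]
  by_contra! ⟨b, hb⟩
  have hα := A.exponent_pos ha.1
  have hpos : 0 < (r ^ b) ^ (a / -Real.log r) := Real.rpow_pos_of_pos (pow_pos A.r_pos _) _
  obtain ⟨N, hN⟩ := Metric.cauchySeq_iff.mp hx.cauchySeq _ (half_pos hpos)
  obtain ⟨n, hn1, hn2⟩ := (hb.and_eventually (eventually_ge_atTop N)).exists
  have hconst : ∀ m ≥ N, x m = x n := by
    intro m hm
    by_contra hne
    have h1 := A.pow_level_le_dist ha (Ne.symm hne)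
    have h2 := hN n hn2 m hm
    rw [UniformSpace.Completion.dist_eq] at h2
    have h3 : (r ^ b) ^ (a / -Real.log r) ≤ (r ^ A.level (x n)) ^ (a / -Real.log r) :=
      Real.rpow_le_rpow (pow_pos A.r_pos _).le
        (pow_le_pow_of_le_one A.r_pos.le A.r_lt_one.le hn1.le) hα.le
    linarith
  refine ξ.2 ⟨x n, ?_⟩
  refine tendsto_nhds_unique (tendsto_const_nhds.congr' ?_) hx
  filter_upwards [eventually_ge_atTop N] with m hm
  rw [hconst m hm]

theorem cauchySeq_pt {a : ℝ} (ha : IsHyperbolicParameter G o a) {x : ℕ → HyperbolicSpace G o a}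
    (hx : CauchySeq x) : CauchySeq fun n => A.pt (x n) := by
  obtain ⟨K, hK, h⟩ := A.exists_dist_pt_le ha
  have hα := A.exponent_pos ha.1
  rw [cauchySeq_iff_tendsto_dist_atTop_0] at hx ⊢
  have h0 : Tendsto (fun n : ℕ × ℕ => (K * dist (x n.1) (x n.2)) ^ (a / -Real.log r)⁻¹) atTop
      (𝓝 0) := by
    have := (hx.const_mul K).rpow_const (p := (a / -Real.log r)⁻¹) (Or.inr (inv_pos.mpr hα).le)
    rwa [mul_zero, Real.zero_rpow (inv_pos.mpr hα).ne'] at this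
  refine squeeze_zero (fun _ => dist_nonneg) (fun n => ?_) h0
  rw [Real.le_rpow_inv_iff_of_pos dist_nonneg (by positivity) hα]
  exact h _ _

/-- The approximated set and the hyperbolic boundary are Hölder equivalent. -/
theorem exists_equiv_boundary [CompleteSpace M] (A : GraphApproximation G o E r) {a : ℝ}
    (ha : IsHyperbolicParameter G o a) :
    ∃ σ : E ≃ HyperbolicBoundary G o a, ∃ K : ℝ, 0 < K ∧ ∀ x y : E,
      dist x y ^ (a / -Real.log r) ≤ K * dist (σ x) (σ y) ∧
        dist (σ x) (σ y) ≤ K * dist x y ^ (a / -Real.log r) := by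
  have hα := A.exponent_pos ha.1
  choose Ψ hΨ using fun e : E => A.exists_boundary_limit ha e.2
  obtain ⟨K₁, hK₁, h₁⟩ := A.exists_dist_le_size ha.1
  obtain ⟨K₂, hK₂, h₂⟩ := A.exists_dist_pt_le ha
  have bounds : ∀ e e' : E, dist e e' ^ (a / -Real.log r) ≤ K₂ * dist (Ψ e) (Ψ e') ∧
      dist (Ψ e) (Ψ e') ≤ K₁ * dist e e' ^ (a / -Real.log r) := by
    intro e e'
    obtain ⟨x, hx, hxe⟩ := A.exists_seq a e.2
    obtain ⟨y, hy, hye⟩ := A.exists_seq a e'.2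
    have hd := (hΨ e x hx hxe).dist (hΨ e' y hy hye)
    simp only [UniformSpace.Completion.dist_eq] at hd
    constructor
    · exact le_of_tendsto_of_tendsto' ((hxe.dist hye).rpow_const (Or.inr hα.le))
        (hd.const_mul K₂) fun n => h₂ _ _
    · exact le_of_tendsto_of_tendsto' hd
        (((A.tendsto_size hx hy hxe hye).rpow_const (Or.inr hα.le)).const_mul K₁) fun n => h₁ _ _
  have hinj : Function.Injective Ψ := by
    intro e e' h
    have := (bounds e e').1
    rw [h, dist_self, mul_zero] at this
    by_contra hne
    exact absurd this (not_le.mpr (Real.rpow_pos_of_pos (dist_pos.mpr hne) _))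
  -- A boundary point is a limit of vertices; their levels tend to infinity and their points form a
  -- Cauchy sequence, whose limit lies in `E` and is the preimage.
  have hsurj : Function.Surjective Ψ := by
    intro ξ
    obtain ⟨u, hu, huξ⟩ := mem_closure_iff_seq_limit.mp
      (UniformSpace.Completion.denseRange_coe (α := HyperbolicSpace G o a) ξ.1)
    choose x hx using hu
    obtain rfl : (fun n => (x n : UniformSpace.Completion (HyperbolicSpace G o a))) = u :=
      funext hx
    have hlev := A.tendsto_level ha ξ huξ
    have hcau : CauchySeq x :=
      (UniformSpace.Completion.isUniformInducing_coe _).cauchy_map_iff.mp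
        (by rw [Filter.map_map]; exact huξ.cauchySeq)
    obtain ⟨e, he⟩ := cauchySeq_tendsto_of_complete (A.cauchySeq_pt ha hcau)
    have heE := A.mem_of_tendsto x e hlev he
    exact ⟨⟨e, heE⟩, Subtype.ext (tendsto_nhds_unique (hΨ ⟨e, heE⟩ x hlev he) huξ)⟩
  refine ⟨Equiv.ofBijective Ψ ⟨hinj, hsurj⟩, max K₁ K₂, lt_max_of_lt_left hK₁, fun e e' => ?_⟩
  refine ⟨(bounds e e').1.trans ?_, (bounds e e').2.trans ?_⟩
  · exact mul_le_mul_of_nonneg_right (le_max_right _ _) dist_nonneg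
  · exact mul_le_mul_of_nonneg_right (le_max_left _ _) (Real.rpow_nonneg dist_nonneg _)

end GraphApproximation

/-! ### Transfer of Lipschitz equivalence through Hölder equivalences -/

/-- Spaces that are Hölder equivalent, with the same exponent, to Lipschitz equivalent spaces are
Lipschitz equivalent. -/
theorem LipschitzEquivalent.of_holder {A B A' B' : Type*} [MetricSpace A] [MetricSpace B]
    [MetricSpace A'] [MetricSpace B'] {α : ℝ} (hα : 0 < α) {σ : A ≃ B} {K : ℝ} (hK : 0 < K)
    (hσ : ∀ x y, dist x y ^ α ≤ K * dist (σ x) (σ y) ∧ dist (σ x) (σ y) ≤ K * dist x y ^ α)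
    {σ' : A' ≃ B'} {K' : ℝ} (hK' : 0 < K')
    (hσ' : ∀ x y, dist x y ^ α ≤ K' * dist (σ' x) (σ' y) ∧
      dist (σ' x) (σ' y) ≤ K' * dist x y ^ α) :
    LipschitzEquivalent A A' ↔ LipschitzEquivalent B B' := by
  constructor
  · rintro ⟨τ, C, hC, h⟩
    refine ⟨(σ.symm.trans τ).trans σ', K * K' * C ^ α, by positivity, fun x y => ?_⟩
    obtain ⟨x, rfl⟩ := σ.surjective x
    obtain ⟨y, rfl⟩ := σ.surjective y
    simp only [Equiv.trans_apply, Equiv.symm_apply_apply]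
    have h1 : dist (τ x) (τ y) ^ α ≤ C ^ α * dist x y ^ α := by
      rw [← Real.mul_rpow hC.le dist_nonneg]
      exact Real.rpow_le_rpow dist_nonneg (h x y).2 hα.le
    have h2 : dist x y ^ α ≤ C ^ α * dist (τ x) (τ y) ^ α := by
      rw [← Real.mul_rpow hC.le dist_nonneg]
      refine Real.rpow_le_rpow dist_nonneg ?_ hα.le
      rw [← inv_mul_le_iff₀ hC]
      exact (h x y).1
    constructor
    · rw [inv_mul_le_iff₀ (by positivity)]
      calc dist (σ x) (σ y) ≤ K * dist x y ^ α := (hσ x y).2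
        _ ≤ K * (C ^ α * dist (τ x) (τ y) ^ α) := by gcongr
        _ ≤ K * (C ^ α * (K' * dist (σ' (τ x)) (σ' (τ y)))) := by
            gcongr
            exact (hσ' _ _).1
        _ = _ := by ring
    · calc dist (σ' (τ x)) (σ' (τ y)) ≤ K' * dist (τ x) (τ y) ^ α := (hσ' _ _).2
        _ ≤ K' * (C ^ α * dist x y ^ α) := by gcongr
        _ ≤ K' * (C ^ α * (K * dist (σ x) (σ y))) := by
            gcongr
            exact (hσ _ _).1
        _ = _ := by ring
  · rintro ⟨τ, C, hC, h⟩
    -- Going back from the Hölder copies, the estimates compare `α`-th powers of distances, so an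
    -- `α`-th root is taken.
    have key : ∀ s t : ℝ, 0 ≤ s → 0 ≤ t → s ^ α ≤ K * K' * C * t ^ α →
        s ≤ (K * K' * C) ^ α⁻¹ * t := by
      intro s t hs ht hst
      have := Real.rpow_le_rpow (Real.rpow_nonneg hs _) hst (inv_pos.mpr hα).le
      rwa [Real.mul_rpow (by positivity) (Real.rpow_nonneg ht _), Real.rpow_rpow_inv hs hα.ne',
        Real.rpow_rpow_inv ht hα.ne'] at this
    refine ⟨(σ.trans τ).trans σ'.symm, (K * K' * C) ^ α⁻¹, by positivity, fun x y => ?_⟩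
    simp only [Equiv.trans_apply]
    obtain ⟨x', hx'⟩ := σ'.surjective (τ (σ x))
    obtain ⟨y', hy'⟩ := σ'.surjective (τ (σ y))
    rw [← hx', ← hy', Equiv.symm_apply_apply, Equiv.symm_apply_apply]
    have h1 := hσ x y
    have h2 := hσ' x' y'
    have h3 := h (σ x) (σ y)
    rw [hx', hy'] at h2
    rw [inv_mul_le_iff₀ hC] at h3
    constructor
    · rw [inv_mul_le_iff₀ (by positivity)]
      refine key _ _ dist_nonneg dist_nonneg ?_
      calc dist x y ^ α ≤ K * dist (σ x) (σ y) := h1.1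
        _ ≤ K * (C * (K' * dist x' y' ^ α)) := by
            gcongr
            exact h3.1.trans (by gcongr; exact h2.2)
        _ = _ := by ring
    · refine key _ _ dist_nonneg dist_nonneg ?_
      calc dist x' y' ^ α ≤ K' * dist (τ (σ x)) (τ (σ y)) := h2.1
        _ ≤ K' * (C * (K * dist x y ^ α)) := by
            gcongr
            exact h3.2.trans (by gcongr; exact h1.2)
        _ = _ := by ring

/-! ### Words and levels -/

namespace MoranParameters

variable {d : ℕ} (P : MoranParameters d)

theorem r_pos : 0 < P.r := P.iInf_ratio_pos

theorem r_le_ratio (k : ℕ) : P.r ≤ P.ratio k :=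
  ciInf_le ⟨0, by rintro _ ⟨k, rfl⟩; exact (P.ratio_pos k).le⟩ k

theorem r_lt_one : P.r < 1 := (P.r_le_ratio 0).trans_lt (P.ratio_lt_one 0)

theorem ratioProd_pos (k : ℕ) : 0 < P.ratioProd k := Finset.prod_pos fun j _ => P.ratio_pos j

theorem ratioProd_zero : P.ratioProd 0 = 1 := Finset.prod_range_zero _

theorem ratioProd_succ (k : ℕ) : P.ratioProd (k + 1) = P.ratioProd k * P.ratio k :=
  Finset.prod_range_succ _ _

theorem ratioProd_antitone : Antitone P.ratioProd :=
  antitone_nat_of_succ_le fun k => by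
    rw [ratioProd_succ]
    exact mul_le_of_le_one_right (P.ratioProd_pos k).le (P.ratio_lt_one k).le

theorem pow_le_ratioProd (k : ℕ) : P.r ^ k ≤ P.ratioProd k := by
  simpa [ratioProd] using Finset.prod_le_prod (s := Finset.range k) (fun _ _ => P.r_pos.le)
    (fun j _ => P.r_le_ratio j)

theorem ratio_le_half (k : ℕ) : P.ratio k ≤ 1 / 2 := by
  have h1 : (2 : ℝ) ≤ P.num k := by exact_mod_cast P.two_le_num k
  nlinarith [P.num_mul_ratio_le_one k, P.ratio_pos k]

theorem ratioProd_le_pow (k : ℕ) : P.ratioProd k ≤ (1 / 2) ^ k := by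
  simpa [ratioProd] using Finset.prod_le_prod (s := Finset.range k) (fun j _ => (P.ratio_pos j).le)
    (fun j _ => P.ratio_le_half j)

variable {P}

/-- The last letter multiplies the product by at least `r`, so a word that just crosses `r ^ n`
stays above `r ^ (n + 1)`. Hence the levels are disjoint. -/
theorem pow_succ_lt_of_mem_level {w : P.Word} {n : ℕ} (hw : w ∈ P.level n) :
    P.r ^ (n + 1) < P.ratioProd w.length := by
  obtain ⟨k, hk⟩ : ∃ k, k = w.length := ⟨_, rfl⟩
  have h2 := hw.2
  rw [← hk] at h2 ⊢
  rcases k with _ | k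
  · rw [ratioProd_zero]
    exact pow_lt_one₀ P.r_pos.le P.r_lt_one (Nat.succ_ne_zero n)
  · rw [ratioProd_succ, pow_succ]
    have h := h2 k.succ_pos
    rw [Nat.add_sub_cancel] at h
    exact mul_lt_mul h (P.r_le_ratio k) P.r_pos (P.ratioProd_pos k).le

theorem level_le_level {u w : P.Word} {m n : ℕ} (hu : u ∈ P.level m) (hw : w ∈ P.level n)
    (h : u.length ≤ w.length) : m ≤ n := by
  have h1 := (pow_succ_lt_of_mem_level hw).trans_le ((P.ratioProd_antitone h).trans hu.1)
  exact Nat.lt_succ_iff.mp ((pow_lt_pow_iff_right_of_lt_one₀ P.r_pos P.r_lt_one).mp h1)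

theorem level_unique {w : P.Word} {m n : ℕ} (hm : w ∈ P.level m) (hn : w ∈ P.level n) : m = n :=
  le_antisymm (level_le_level hm hn le_rfl) (level_le_level hn hm le_rfl)

theorem le_length_of_mem_level {w : P.Word} {n : ℕ} (hw : w ∈ P.level n) : n ≤ w.length :=
  (pow_le_pow_iff_right_of_lt_one₀ P.r_pos P.r_lt_one).mp
    ((P.pow_le_ratioProd _).trans hw.1)

variable (P) in
-- Ratios are at most `1/2`, so the products tend to zero and the first `k` with product at most `r
-- ^ n` exists. Membership in a level depends on the length alone, so every word of length `k` lies
-- in `X_n`.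
theorem exists_length (n : ℕ) :
    ∃ k, P.ratioProd k ≤ P.r ^ n ∧ (0 < k → P.r ^ n < P.ratioProd (k - 1)) := by
  classical
  have h : ∃ k, P.ratioProd k ≤ P.r ^ n := by
    obtain ⟨k, hk⟩ := exists_pow_lt_of_lt_one (pow_pos P.r_pos n) (one_half_lt_one (α := ℝ))
    exact ⟨k, (P.ratioProd_le_pow k).trans hk.le⟩
  exact ⟨Nat.find h, Nat.find_spec h, fun h0 =>
    not_le.mp (Nat.find_min h (Nat.sub_lt h0 one_pos))⟩

/-- The prefix of length at most `k` of a word. -/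
def Word.take (w : P.Word) (k : ℕ) : P.Word :=
  ⟨w.1.take k, fun j h => by
    rw [List.getElem_take]
    exact w.2 j (h.trans_le (List.length_take_le' _ _))⟩

theorem Word.take_prefix (w : P.Word) (k : ℕ) : (w.take k).1 <+: w.1 := List.take_prefix _ _

theorem Word.length_take {w : P.Word} {k : ℕ} (h : k ≤ w.length) : (w.take k).length = k := by
  simpa [Word.take, Word.length] using h

theorem Word.exists_eq_child {w : P.Word} {k : ℕ} (h : w.length = k + 1) :
    ∃ i : Fin (P.num (w.take k).length), w = (w.take k).child i := by
  have hk : k < w.1.length := by rw [Word.length] at h; omega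
  have hl : (w.take k).length = k := Word.length_take (by omega)
  refine ⟨⟨w.1[k], by rw [hl]; exact w.2 k hk⟩, Subtype.ext ?_⟩
  simp only [Word.child, Word.take, List.take_append_getElem]
  rw [List.take_of_length_le]
  exact h.le

theorem finite_length_eq (k : ℕ) : {w : P.Word | w.length = k}.Finite := by
  let f : {w : P.Word | w.length = k} → ((j : Fin k) → Fin (P.num j)) := fun w j =>
    ⟨w.1.1[j.1]'(by have h : w.1.1.length = k := w.2; omega), w.1.2 _ _⟩
  have hf : Function.Injective f := by
    rintro ⟨⟨u, hu⟩, hul⟩ ⟨⟨v, hv⟩, hvl⟩ h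
    have hul' : u.length = k := hul
    have hvl' : v.length = k := hvl
    have : u = v := List.ext_getElem (hul'.trans hvl'.symm) fun j h1 h2 => by
      have := congrFun h ⟨j, by omega⟩
      simpa [f] using this
    subst this
    rfl
  exact Set.finite_coe_iff.mp (Finite.of_injective f hf)

theorem exists_parent {w : P.Word} {n : ℕ} (hw : w ∈ P.level (n + 1)) :
    ∃ u ∈ P.level n, u.1 <+: w.1 := by
  obtain ⟨k, hk1, hk2⟩ := P.exists_length n
  have hk : k ≤ w.length := by
    by_contra! h
    have h1 : P.r ^ n < P.ratioProd (k - 1) := hk2 (by omega)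
    have h2 : P.ratioProd (k - 1) ≤ P.ratioProd w.length := P.ratioProd_antitone (by omega)
    have h3 : P.r ^ (n + 1) ≤ P.r ^ n :=
      pow_le_pow_of_le_one P.r_pos.le P.r_lt_one.le n.le_succ
    linarith [hw.1]
  refine ⟨w.take k, ?_, w.take_prefix k⟩
  simp only [level, Set.mem_ofPred_eq, Word.length_take hk]
  exact ⟨hk1, hk2⟩

end MoranParameters

/-! ### The augmented tree approximates the Moran set -/

namespace MoranStructure

open MoranParameters

variable {d : ℕ} {P : MoranParameters d} (F : MoranStructure P)

theorem isCompact_piece (w : P.Word) : IsCompact (F.piece w) := by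
  obtain ⟨S, hS⟩ := F.similar w
  rw [hS]
  exact P.isCompact_J.image (Dilation.toContinuous S)

theorem piece_nonempty (w : P.Word) : (F.piece w).Nonempty := by
  obtain ⟨S, hS⟩ := F.similar w
  rw [hS]
  exact (P.interior_J_nonempty.mono interior_subset).image S

/-- For `d = 0` the set `J` has nonempty interior but zero diameter. The diameter ratios exclude
this: division by zero gives `0`, which is not a ratio of the class. -/
theorem diam_pos (F : MoranStructure P) : 0 < Metric.diam P.J := by
  refine lt_of_le_of_ne Metric.diam_nonneg fun h => ?_
  have h1 := F.diam_child P.emptyWord ⟨0, two_pos.trans_le (P.two_le_num _)⟩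
  rw [F.piece_empty, ← h, div_zero] at h1
  exact (P.ratio_pos _).ne h1

theorem diam_piece (w : P.Word) :
    Metric.diam (F.piece w) = P.ratioProd w.length * Metric.diam P.J := by
  obtain ⟨k, hk⟩ : ∃ k, w.length = k := ⟨_, rfl⟩
  induction k generalizing w with
  | zero =>
    have : w = P.emptyWord := Subtype.ext (List.eq_nil_of_length_eq_zero hk)
    rw [hk, ratioProd_zero, one_mul, this, F.piece_empty]
  | succ k ih =>
    have hl : (w.take k).length = k := Word.length_take (by omega)
    obtain ⟨i, hi⟩ := Word.exists_eq_child hk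
    have h := F.diam_child _ i
    have ih' := ih _ hl
    rw [← hi, ih', div_eq_iff (mul_pos (P.ratioProd_pos _) F.diam_pos).ne', hl] at h
    rw [h, hk, ratioProd_succ]
    ring

theorem piece_subset_of_prefix {u w : P.Word} (h : u.1 <+: w.1) : F.piece w ⊆ F.piece u := by
  obtain ⟨k, hk⟩ : ∃ k, w.length = k := ⟨_, rfl⟩
  induction k generalizing w with
  | zero =>
    have hw : w.1 = [] := List.eq_nil_of_length_eq_zero hk
    have : u = w := Subtype.ext (by rw [hw] at h ⊢; exact List.prefix_nil.mp h)
    rw [this]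
  | succ k ih =>
    by_cases hu : u.1.length = w.1.length
    · rw [Subtype.ext (h.eq_of_length hu)]
    · have hl : (w.take k).length = k := Word.length_take (by omega)
      obtain ⟨i, hi⟩ := Word.exists_eq_child hk
      have hsub := F.child_subset _ i
      rw [← hi] at hsub
      refine hsub.trans (ih (List.prefix_of_prefix_length_le h (w.take_prefix k) ?_) hl)
      have h1 := h.length_le
      have h2 : (w.take k).1.length = k := hl
      have h3 : w.1.length = k + 1 := hk
      omega

theorem diam_piece_le {w : P.Word} {n : ℕ} (hw : w ∈ P.level n) :
    Metric.diam (F.piece w) ≤ Metric.diam P.J * P.r ^ n := by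
  rw [F.diam_piece, mul_comm]
  exact mul_le_mul_of_nonneg_left hw.1 F.diam_pos.le

theorem isClosed_biUnion_piece (k : ℕ) :
    IsClosed (⋃ w ∈ {w : P.Word | w.length = k}, F.piece w) :=
  (finite_length_eq k).isClosed_biUnion fun w _ => (F.isCompact_piece w).isClosed

theorem adj_iff {u v : P.Vertex} : F.augmentedTree.Adj u v ↔
    u ≠ v ∧ ((∃ n, u.1 ∈ P.level n ∧ v.1 ∈ P.level (n + 1) ∧ u.1.1 <+: v.1.1) ∨
      (∃ n, v.1 ∈ P.level n ∧ u.1 ∈ P.level (n + 1) ∧ v.1.1 <+: u.1.1) ∨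
      ∃ n, 0 < n ∧ u.1 ∈ P.level n ∧ v.1 ∈ P.level n ∧
        (F.piece u.1 ∩ F.piece v.1).Nonempty) := by
  simp only [augmentedTree, verticalGraph, horizontalGraph, SimpleGraph.sup_adj,
    SimpleGraph.fromRel_adj]
  constructor
  · rintro (⟨h, h1 | h1⟩ | ⟨h, h1 | ⟨n, h0, h1, h2, h3⟩⟩)
    · exact ⟨h, Or.inl h1⟩
    · exact ⟨h, Or.inr (Or.inl h1)⟩
    · exact ⟨h, Or.inr (Or.inr h1)⟩
    · exact ⟨h, Or.inr (Or.inr ⟨n, h0, h2, h1, by rwa [Set.inter_comm]⟩)⟩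
  · rintro ⟨h, h1 | h1 | h1⟩
    · exact Or.inl ⟨h, Or.inl h1⟩
    · exact Or.inl ⟨h, Or.inr h1⟩
    · exact Or.inr ⟨h, Or.inl h1⟩

theorem piece_inter_nonempty_of_adj {u v : P.Vertex} (h : F.augmentedTree.Adj u v) :
    (F.piece u.1 ∩ F.piece v.1).Nonempty := by
  obtain ⟨-, ⟨n, -, -, hp⟩ | ⟨n, -, -, hp⟩ | ⟨n, -, -, -, hp⟩⟩ := F.adj_iff.mp h
  · rw [Set.inter_eq_right.mpr (F.piece_subset_of_prefix hp)]
    exact F.piece_nonempty _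
  · rw [Set.inter_eq_left.mpr (F.piece_subset_of_prefix hp)]
    exact F.piece_nonempty _
  · exact hp

/-- Every vertex is joined to an ancestor in each lower level by a path of vertical edges. -/
theorem exists_walk_ancestor (m j : ℕ) (x : P.Vertex) (hx : x.1 ∈ P.level (m + j)) :
    ∃ u : P.Vertex, u.1 ∈ P.level m ∧ F.piece x.1 ⊆ F.piece u.1 ∧
      ∃ W : F.augmentedTree.Walk x u, W.length = j := by
  induction j generalizing x with
  | zero => exact ⟨x, hx, subset_rfl, .nil, rfl⟩
  | succ j ih =>
    obtain ⟨y, hy, hyx⟩ := exists_parent hx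
    obtain ⟨u, hu, hsub, W, hW⟩ := ih ⟨y, _, hy⟩ hy
    have hne : x ≠ ⟨y, _, hy⟩ := by
      rintro rfl
      exact (m + j).succ_ne_self (level_unique hx hy)
    have hadj : F.augmentedTree.Adj x ⟨y, _, hy⟩ :=
      F.adj_iff.mpr ⟨hne, Or.inr (Or.inl ⟨m + j, hy, hx, hyx⟩)⟩
    exact ⟨u, hu, (F.piece_subset_of_prefix hyx).trans hsub, .cons hadj W, by
      rw [SimpleGraph.Walk.length_cons, hW]⟩

theorem eq_root_of_mem_level_zero {u : P.Vertex} (hu : u.1 ∈ P.level 0) : u = P.root := by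
  rw [P.level_zero] at hu
  exact Subtype.ext hu

/-- The augmented tree of a Moran structure with condition (H) approximates the Moran set. -/
theorem exists_graphApproximation (hF : F.ConditionH) :
    Nonempty (GraphApproximation F.augmentedTree P.root F.moranSet P.r) := by
  obtain ⟨c, hc, hH⟩ := hF
  let lev : P.Vertex → ℕ := fun v => v.2.choose
  have hlev : ∀ v : P.Vertex, v.1 ∈ P.level (lev v) := fun v => v.2.choose_spec
  choose p hp using F.piece_nonempty
  have hdist : ∀ (w : P.Word) (n : ℕ), w ∈ P.level n → ∀ x ∈ F.piece w, ∀ y ∈ F.piece w,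
      dist x y ≤ Metric.diam P.J * P.r ^ n := fun w n hw x hx y hy =>
    (Metric.dist_le_diam_of_mem (F.isCompact_piece w).isBounded hx hy).trans (F.diam_piece_le hw)
  have hr := P.r_pos
  -- The three terms serve `1 ≤ C`, the diameters of the pieces, and the separation constant `c` of
  -- (H).
  obtain ⟨C, hC⟩ : ∃ C, C = 1 + Metric.diam P.J + c⁻¹ := ⟨_, rfl⟩
  have hdiam := F.diam_pos
  have hci := inv_pos.mpr hc
  have hdC : Metric.diam P.J ≤ C := by linarith
  refine ⟨{
    level := lev
    pt := fun v => p v.1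
    C := C
    r_pos := P.r_pos
    r_lt_one := P.r_lt_one
    one_le_C := by linarith
    level_root := level_unique (hlev _) (by rw [P.level_zero]; rfl)
    level_le_of_adj := ?_
    dist_le_of_adj := ?_
    exists_walk_root := ?_
    exists_walk := ?_
    exists_near := ?_
    mem_of_tendsto := ?_ }⟩
  · intro u v h
    obtain ⟨-, ⟨n, hu, hv, -⟩ | ⟨n, hv, hu, -⟩ | ⟨n, -, hu, hv, -⟩⟩ := F.adj_iff.mp h <;>
    · have := level_unique (hlev u) hu
      have := level_unique (hlev v) hv
      omega
  · intro u v h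
    obtain ⟨z, hzu, hzv⟩ := F.piece_inter_nonempty_of_adj h
    calc dist (p u.1) (p v.1) ≤ dist (p u.1) z + dist z (p v.1) := dist_triangle _ _ _
      _ ≤ C * P.r ^ lev u + C * P.r ^ lev v := by
          refine add_le_add ((hdist _ _ (hlev u) _ (hp _) _ hzu).trans ?_)
            ((hdist _ _ (hlev v) _ hzv _ (hp _)).trans ?_) <;> gcongr
      _ = _ := by ring
  · intro x
    obtain ⟨u, hu, -, W, hW⟩ := F.exists_walk_ancestor 0 (lev x) x (by rw [zero_add]; exact hlev x)
    obtain rfl := eq_root_of_mem_level_zero hu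
    exact ⟨W.reverse, by rw [SimpleGraph.Walk.length_reverse, hW]⟩
  · intro x y m hx hy hd
    obtain ⟨u, hu, hxu, W, hW⟩ := F.exists_walk_ancestor m (lev x - m) x (by
      rw [Nat.add_sub_cancel' hx]; exact hlev x)
    obtain ⟨v, hv, hyv, W', hW'⟩ := F.exists_walk_ancestor m (lev y - m) y (by
      rw [Nat.add_sub_cancel' hy]; exact hlev y)
    -- Climb from `x` and `y` to their ancestors at level `m`; at most one horizontal edge joins
    -- these, which is the `+ 1` in `exists_walk`.
    suffices h : ∃ W₀ : F.augmentedTree.Walk u v, W₀.length ≤ 1 by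
      obtain ⟨W₀, hW₀⟩ := h
      refine ⟨(W.append W₀).append W'.reverse, ?_⟩
      simp only [SimpleGraph.Walk.length_append, SimpleGraph.Walk.length_reverse]
      omega
    by_cases huv : u = v
    · subst huv
      exact ⟨.nil, Nat.zero_le _⟩
    have hm : 0 < m := by
      by_contra h
      obtain rfl : m = 0 := by omega
      exact huv ((eq_root_of_mem_level_zero hu).trans (eq_root_of_mem_level_zero hv).symm)
    -- The pieces of the ancestors contain the points of `x` and `y`, which are closer than `c * r ^
    -- m`, so (H) leaves only intersection.
    have hne : (F.piece u.1 ∩ F.piece v.1).Nonempty := by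
      refine (hH m hm u.1 hu v.1 hv).resolve_right fun h => ?_
      have h1 := h _ (hxu (hp _)) _ (hyv (hp _))
      have h2 : c⁻¹ * dist (p x.1) (p y.1) ≤ C * dist (p x.1) (p y.1) := by
        gcongr
        linarith
      rw [← le_inv_mul_iff₀ hc] at h1
      linarith
    exact ⟨(F.adj_iff.mpr ⟨huv, Or.inr (Or.inr ⟨m, hm, hu, hv, hne⟩)⟩).toWalk, by simp⟩
  · intro e he n
    obtain ⟨k, hk1, hk2⟩ := P.exists_length n
    have hek := Set.mem_iInter.mp he k
    simp only [Set.mem_iUnion, Set.mem_ofPred_eq] at hek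
    obtain ⟨w, hw, hew⟩ := hek
    have hwn : w ∈ P.level n := by
      rw [← hw] at hk1 hk2
      exact ⟨hk1, hk2⟩
    refine ⟨⟨w, n, hwn⟩, level_unique (hlev ⟨w, n, hwn⟩) hwn, ?_⟩
    refine (hdist w n hwn _ (hp _) _ hew).trans ?_
    gcongr
  · intro x e hx he
    -- The points themselves need not lie in the Moran set, but those of level at least `k` lie in
    -- the closed union of the pieces of length `k`.
    refine Set.mem_iInter.mpr fun k => (F.isClosed_biUnion_piece k).mem_of_tendsto he ?_
    filter_upwards [hx.eventually_ge_atTop k] with n hn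
    have hl : k ≤ (x n).1.length := hn.trans (le_length_of_mem_level (hlev (x n)))
    exact Set.mem_biUnion (Word.length_take hl)
      (F.piece_subset_of_prefix ((x n).1.take_prefix k) (hp _))

end MoranStructure

theorem corollary4p7 {d : ℕ} (P : MoranParameters d) (F F' : MoranStructure P)
    (hF : F.ConditionH) (hF' : F'.ConditionH) :
    IsHyperbolicGraph F.augmentedTree P.root ∧ IsHyperbolicGraph F'.augmentedTree P.root ∧
      ∀ a : ℝ, IsHyperbolicParameter F.augmentedTree P.root a →
        IsHyperbolicParameter F'.augmentedTree P.root a →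
        (LipschitzEquivalent F.moranSet F'.moranSet ↔
          LipschitzEquivalent (F.Boundary a) (F'.Boundary a)) := by
  obtain ⟨A⟩ := F.exists_graphApproximation hF
  obtain ⟨A'⟩ := F'.exists_graphApproximation hF'
  refine ⟨A.isHyperbolicGraph, A'.isHyperbolicGraph, fun a ha ha' => ?_⟩
  obtain ⟨σ, K, hK, hσ⟩ := A.exists_equiv_boundary ha
  obtain ⟨σ', K', hK', hσ'⟩ := A'.exists_equiv_boundary ha'
  -- Both equivalences have the exponent `a / -log r` with the same `r`, as the families share their
  -- parameters.
  exact LipschitzEquivalent.of_holder (A.exponent_pos ha.1) hK hσ hK' hσ'
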